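/- Let $\mathcal H_1,\mathcal H_2$ be complex Hilbert spaces, $A_\gamma$ a (possibly unbounded) self-adjoint operator in $\mathcal H_\gamma$ with spectrum $\sigma_\gamma$ and spectral measure $E_\gamma$ ($\gamma=1,2$), and assume $d_0=\operatorname{dist}(\sigma_1,\sigma_2)>0$. Let $\{\alpha,\beta\}=\{1,2\}$, let $B_{\alpha\beta}:\mathcal H_\beta\to\mathcal H_\alpha$ be a bounded operator with finite Hilbert–Schmidt norm $\|B_{\alpha\beta}\|_2$, and put $B_{\beta\alpha}=B_{\alpha\beta}^*$. For an operator $Y$ in $\mathcal H_\alpha$ such that $(Y-\mu)^{-1}$ exists as a bounded operator for every $\mu\in\sigma_\beta$ and $\sup_{\mu\in\sigma_\beta}\|(Y-\mu)^{-1}\|<\infty$, let $\int_{\sigma_\beta}E_\beta(d\mu)B_{\beta\alpha}(Y-\mu)^{-1}$ denote, when it exists, the operator-norm limit of the sums $\sum_k E_\beta(S_k\cap\sigma_\beta)B_{\beta\alpha}T_k$ belonging to a uniformly bounded sequence of step functions (with value $T_k$, a bounded operator on $\mathcal H_\alpha$, on the Borel set $S_k$) that converges in operator norm to $(Y-\mu)^{-1}$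 at every $\mu\in\sigma_\beta$, and put $$V_\alpha(Y)=B_{\alpha\beta}\int_{\sigma_\beta}E_\beta(d\mu)\,B_{\beta\alpha}(Y-\mu)^{-1}.$$ A bounded operator $Q_{\beta\alpha}:\mathcal H_\alpha\to\mathcal H_\beta$ is called a solution of $$Q_{\beta\alpha}=\int_{\sigma_\beta}E_\beta(d\mu)\,B_{\beta\alpha}\,(A_\alpha+B_{\alpha\beta}Q_{\beta\alpha}-\mu)^{-1}\qquad(*)$$ if these inverses exist as bounded operators, uniformly bounded in $\mu\in\sigma_\beta$, the integral exists, and $(*)$ holds. 1. For every $\delta>0$ with $\|B_{\alpha\beta}\|_2<d_0\min\left\{\frac1{1+\delta},\frac{\delta}{1+\delta^2}\right\}$, equation $(*)$ has exactly one solution $Q_{\beta\alpha}$ with $\|Q_{\beta\alpha}\|\le\delta$. 2. In particular, if $\|B_{\alpha\beta}\|_2<\frac12d_0$, then $(*)$ has exactly one solution with $\|Q_{\beta\alpha}\|\le1$. 3. If $Q_{\beta\alpha}$ is a solution of $(*)$, then the operator $H_\alpha=A_\alpha+B_{\alpha\beta}Q_{\beta\alpha}$ with domain $\mathcal D(A_\alpha)$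 is a solution of $H_\alpha=A_\alpha+V_\alpha(H_\alpha)$ (with $V_\alpha(H_\alpha)$ well defined as above). -/

import Mathlib

open Filter Topology MeasureTheory
open scoped ENNReal InnerProductSpace ComplexInnerProductSpace

noncomputable section

/-! ### Hilbert-Schmidt norm -/

section HilbertSchmidt

variable {E : Type*} {F : Type*}
  [NormedAddCommGroup E] [InnerProductSpace ℂ E]
  [NormedAddCommGroup F] [InnerProductSpace ℂ F]

theorem HilbertBasis.tsum_enorm_inner_sq {ι : Type*} (b : HilbertBasis ι ℂ E) (x : E) :
    ∑' i, ‖⟪b i, x⟫_ℂ‖ₑ ^ 2 = ‖x‖ₑ ^ 2 := by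
  have h := (b.hasSum_inner_mul_inner x x).mapL Complex.reCLM
  have h2 : HasSum (fun i => ‖⟪b i, x⟫_ℂ‖ ^ 2) (‖x‖ ^ 2) := by
    convert h using 1
    · funext i
      have h3 : ⟪x, b i⟫_ℂ * ⟪b i, x⟫_ℂ = ((‖⟪b i, x⟫_ℂ‖ ^ 2 : ℝ) : ℂ) := by
        rw [← inner_conj_symm x (b i), RCLike.conj_mul]
        norm_cast
      rw [h3]
      rw [Complex.reCLM_apply, Complex.ofReal_re]
    · rw [inner_self_eq_norm_sq_to_K]
      simp only [Complex.reCLM_apply]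
      norm_cast
  have h4 := ENNReal.ofReal_tsum_of_nonneg (fun i => sq_nonneg ‖⟪b i, x⟫_ℂ‖) h2.summable
  rw [h2.tsum_eq] at h4
  simpa [ENNReal.ofReal_pow] using h4.symm

variable [CompleteSpace E] [CompleteSpace F]

/-- The Hilbert-Schmidt norm `(∑ ‖T e‖ ^ 2) ^ (1 / 2)`, the sum running over an orthonormal basis,
with value `∞` if `T` is not Hilbert-Schmidt. -/
def hsNorm (T : E →L[ℂ] F) : ℝ≥0∞ :=
  (∑' e : (exists_hilbertBasis ℂ E).choose, ‖T (e : E)‖ₑ ^ 2) ^ (1 / 2 : ℝ)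

theorem tsum_enorm_sq_eq_adjoint {ι κ : Type*} (b : HilbertBasis ι ℂ E) (f : HilbertBasis κ ℂ F)
    (T : E →L[ℂ] F) :
    ∑' i, ‖T (b i)‖ₑ ^ 2 = ∑' j, ‖ContinuousLinearMap.adjoint T (f j)‖ₑ ^ 2 := by
  simp_rw [← f.tsum_enorm_inner_sq (T _)]
  rw [ENNReal.tsum_comm]
  refine tsum_congr fun j => ?_
  rw [← b.tsum_enorm_inner_sq]
  refine tsum_congr fun i => ?_
  rw [ContinuousLinearMap.adjoint_inner_right, ← inner_conj_symm, RCLike.enorm_conj]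

/-- The Hilbert-Schmidt norm may be computed in any orthonormal basis. -/
theorem hsNorm_eq {ι : Type*} (b : HilbertBasis ι ℂ E) (T : E →L[ℂ] F) :
    hsNorm T = (∑' i, ‖T (b i)‖ₑ ^ 2) ^ (1 / 2 : ℝ) := by
  obtain ⟨w, f, -⟩ := exists_hilbertBasis ℂ F
  obtain ⟨c, hc⟩ := (exists_hilbertBasis ℂ E).choose_spec
  have h := tsum_enorm_sq_eq_adjoint c f T
  rw [hc] at h
  rw [hsNorm, h, tsum_enorm_sq_eq_adjoint b f T]

end HilbertSchmidt

/-! ### Spectrum and resolvent of unbounded operators -/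

section Resolvent

variable {H : Type*} [NormedAddCommGroup H] [InnerProductSpace ℂ H]

/-- The bounded operator `R` is the two-sided inverse `(Y - z)⁻¹`. -/
def IsResolventAt (Y : H →ₗ.[ℂ] H) (z : ℂ) (R : H →L[ℂ] H) : Prop :=
  (∀ x : H, ∃ h : R x ∈ Y.domain, Y ⟨R x, h⟩ - z • R x = x) ∧
    ∀ x : Y.domain, R (Y x - z • (x : H)) = x

def opResolventSet (Y : H →ₗ.[ℂ] H) : Set ℂ := {z | ∃ R, IsResolventAt Y z R}

def opSpectrum (Y : H →ₗ.[ℂ] H) : Set ℂ := (opResolventSet Y)ᶜ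

/-- The real points of the spectrum; for a self-adjoint operator this is the whole spectrum. -/
def realSpectrum (Y : H →ₗ.[ℂ] H) : Set ℝ := {μ | (μ : ℂ) ∈ opSpectrum Y}

open Classical in
/-- `(Y - z)⁻¹` for `z` in the resolvent set (and `0` otherwise). -/
def opResolvent (Y : H →ₗ.[ℂ] H) (z : ℂ) : H →L[ℂ] H :=
  if h : ∃ R, IsResolventAt Y z R then h.choose else 0

/-- The distance between the spectra of two operators. -/
def specDist {K : Type*} [NormedAddCommGroup K] [InnerProductSpace ℂ K]
    (A : H →ₗ.[ℂ] H) (A' : K →ₗ.[ℂ] K) : ℝ≥0∞ :=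
  ⨅ z ∈ opSpectrum A, ⨅ w ∈ opSpectrum A', edist z w

end Resolvent

/-! ### Spectral measures -/

section SpectralMeasure

variable {H : Type*} [NormedAddCommGroup H] [InnerProductSpace ℂ H] [CompleteSpace H]

/-- Projection-valued measures on the Borel sets of `ℝ` (the values on other sets are
irrelevant). -/
structure ProjMeasure (H : Type*) [NormedAddCommGroup H] [InnerProductSpace ℂ H]
    [CompleteSpace H] where
  toFun : Set ℝ → H →L[ℂ] H
  isStarProjection : ∀ S, MeasurableSet S → IsStarProjection (toFun S)
  univ : toFun Set.univ = 1
  inter : ∀ S T, MeasurableSet S → MeasurableSet T → toFun (S ∩ T) = toFun S ∘L toFun T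
  hasSum_iUnion : ∀ S : ℕ → Set ℝ, (∀ n, MeasurableSet (S n)) →
    Pairwise (Function.onFun Disjoint S) → ∀ x, HasSum (fun n => toFun (S n) x) (toFun (⋃ n, S n) x)

namespace ProjMeasure

theorem empty (E : ProjMeasure H) : E.toFun ∅ = 0 := by
  ext x
  have h := E.hasSum_iUnion (fun _ => ∅) (fun _ => MeasurableSet.empty)
    (fun _ _ _ => by simp [Function.onFun]) x
  simpa using (summable_const_iff _).1 h.summable

theorem inner_self (E : ProjMeasure H) {S : Set ℝ} (hS : MeasurableSet S) (x : H) :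
    ⟪x, E.toFun S x⟫_ℂ = ((‖E.toFun S x‖ ^ 2 : ℝ) : ℂ) := by
  have h := E.isStarProjection S hS
  have h1 : E.toFun S (E.toFun S x) = E.toFun S x := by
    have := congrArg (fun T : H →L[ℂ] H => T x) h.isIdempotentElem.eq
    simpa using this
  have h2 : ContinuousLinearMap.adjoint (E.toFun S) = E.toFun S := h.isSelfAdjoint
  conv_lhs => rw [← h1, ← ContinuousLinearMap.adjoint_inner_left, h2, inner_self_eq_norm_sq_to_K]
  norm_cast

/-- The scalar spectral measure `S ↦ ⟪x, E(S) x⟫ = ‖E(S) x‖ ^ 2`. -/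
def scalar (E : ProjMeasure H) (x : H) : Measure ℝ :=
  Measure.ofMeasurable (fun S _ => ‖E.toFun S x‖ₑ ^ 2) (by simp [E.empty]) (by
    intro S hS hd
    have h := ((E.hasSum_iUnion S hS hd x).mapL (innerSL ℂ x)).mapL Complex.reCLM
    have h2 : HasSum (fun n => ‖E.toFun (S n) x‖ ^ 2) (‖E.toFun (⋃ n, S n) x‖ ^ 2) := by
      convert h using 1
      · funext n
        simp only [innerSL_apply_apply, E.inner_self (hS n), Complex.reCLM_apply, Complex.ofReal_re]
      · simp only [innerSL_apply_apply, E.inner_self (MeasurableSet.iUnion hS),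
          Complex.reCLM_apply, Complex.ofReal_re]
    have h4 := ENNReal.ofReal_tsum_of_nonneg (fun n => sq_nonneg ‖E.toFun (S n) x‖) h2.summable
    rw [h2.tsum_eq] at h4
    simpa [ENNReal.ofReal_pow] using h4)

theorem scalar_apply (E : ProjMeasure H) (x : H) {S : Set ℝ} (hS : MeasurableSet S) :
    E.scalar x S = ‖E.toFun S x‖ₑ ^ 2 :=
  Measure.ofMeasurable_apply S hS

end ProjMeasure

/-- `E` is the spectral measure of `A`, that is `A = ∫ t E(dt)`: the domain of `A` consists of
the `x` with `∫ t ^ 2 ⟪x, E(dt) x⟫ < ∞`, and `⟪x, A x⟫ = ∫ t ⟪x, E(dt) x⟫` on it (which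
determines `A x` by polarization). -/
structure IsSpectralMeasure (A : H →ₗ.[ℂ] H) (E : ProjMeasure H) : Prop where
  mem_domain_iff : ∀ x : H, x ∈ A.domain ↔ ∫⁻ t, ‖t‖ₑ ^ 2 ∂(E.scalar x) < ∞
  inner_apply : ∀ x : A.domain, ⟪(x : H), A x⟫_ℂ = ((∫ t, t ∂(E.scalar (x : H)) : ℝ) : ℂ)

end SpectralMeasure

/-! ### Integrals `∫ E(dμ) C F(μ)` and the nonlinear equations -/

section Integral

variable {H : Type*} {K : Type*}
  [NormedAddCommGroup H] [InnerProductSpace ℂ H] [CompleteSpace H]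
  [NormedAddCommGroup K] [InnerProductSpace ℂ K] [CompleteSpace K]

/-- `∫_σ E(dμ) C φ(μ) = ∑ₖ E(Sₖ ∩ σ) C Tₖ` for the step function `φ` with value `Tₖ` on `Sₖ`. -/
def simpleIntegral (E : ProjMeasure K) (σ : Set ℝ) (C : H →L[ℂ] K)
    (φ : SimpleFunc ℝ (H →L[ℂ] H)) : H →L[ℂ] K :=
  ∑ T ∈ φ.range, E.toFun (φ ⁻¹' {T} ∩ σ) ∘L C ∘L T

/-- `J = ∫_σ E(dμ) C F(μ)`: as for scalar functions, `J` is the limit of the integrals of a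
bounded sequence of step functions that converges to `F` pointwise on `σ`. For a Hilbert-Schmidt
operator `C` the limit does not depend on the sequence. -/
def HasSpectralIntegral (E : ProjMeasure K) (σ : Set ℝ) (C : H →L[ℂ] K)
    (F : ℝ → H →L[ℂ] H) (J : H →L[ℂ] K) : Prop :=
  ∃ φ : ℕ → SimpleFunc ℝ (H →L[ℂ] H),
    (∃ M : ℝ, ∀ n, ∀ μ ∈ σ, ‖φ n μ‖ ≤ M) ∧
    (∀ μ ∈ σ, Tendsto (fun n => φ n μ) atTop (𝓝 (F μ))) ∧
    Tendsto (fun n => simpleIntegral E σ C (φ n)) atTop (𝓝 J)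

open Classical in
/-- `∫_σ E(dμ) C F(μ)` (and `0` if the integral does not exist). -/
def spectralIntegral (E : ProjMeasure K) (σ : Set ℝ) (C : H →L[ℂ] K)
    (F : ℝ → H →L[ℂ] H) : H →L[ℂ] K :=
  if h : ∃ J, HasSpectralIntegral E σ C F J then h.choose else 0

/-- The integral `∫_σ E(dμ) C (Y - μ)⁻¹` makes sense: `(Y - μ)⁻¹` exists and is uniformly bounded
for `μ ∈ σ`, and the integral converges. -/
structure Admissible (E : ProjMeasure K) (σ : Set ℝ) (C : H →L[ℂ] K) (Y : H →ₗ.[ℂ] H) :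
    Prop where
  mem_resolventSet : ∀ μ ∈ σ, (μ : ℂ) ∈ opResolventSet Y
  bounded : ∃ M : ℝ, ∀ μ ∈ σ, ‖opResolvent Y μ‖ ≤ M
  integrable : ∃ J, HasSpectralIntegral E σ C (fun μ => opResolvent Y μ) J

/-- The operator `A + W` on the domain of `A`, for bounded `W`. -/
def addBounded (A : H →ₗ.[ℂ] H) (W : H →L[ℂ] H) : H →ₗ.[ℂ] H :=
  (W : H →ₗ[ℂ] H) +ᵥ A

/-- With `A = A_α` on `H`, `A' = A_β` on `K`, `E` the spectral measure of `A'` and `B = B_{αβ}`,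
so that `B_{βα} = B*`: the operator `Q` solves
`Q = ∫_{σ(A')} E(dμ) B* (A + B Q - μ)⁻¹`. -/
def SolvesQEquation (A : H →ₗ.[ℂ] H) (A' : K →ₗ.[ℂ] K) (E : ProjMeasure K) (B : K →L[ℂ] H)
    (Q : H →L[ℂ] K) : Prop :=
  Admissible E (realSpectrum A') (ContinuousLinearMap.adjoint B) (addBounded A (B ∘L Q)) ∧
    Q = spectralIntegral E (realSpectrum A') (ContinuousLinearMap.adjoint B)
      (fun μ => opResolvent (addBounded A (B ∘L Q)) μ)

/-- `V(Y) = B ∫_{σ(A')} E(dμ) B* (Y - μ)⁻¹`. -/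
def potential (A' : K →ₗ.[ℂ] K) (E : ProjMeasure K) (B : K →L[ℂ] H) (Y : H →ₗ.[ℂ] H) :
    H →L[ℂ] H :=
  B ∘L spectralIntegral E (realSpectrum A') (ContinuousLinearMap.adjoint B)
    (fun μ => opResolvent Y μ)

/-- `Y` solves `Y = A + V(Y)`. -/
def SolvesBasicEquation (A : H →ₗ.[ℂ] H) (A' : K →ₗ.[ℂ] K) (E : ProjMeasure K)
    (B : K →L[ℂ] H) (Y : H →ₗ.[ℂ] H) : Prop :=
  Admissible E (realSpectrum A') (ContinuousLinearMap.adjoint B) Y ∧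
    Y = addBounded A (potential A' E B Y)

end Integral

end

/-! Equation (*) is a fixed-point equation `Q = Φ Q`, solved by contraction on the closed ball of
radius δ. Write `b` for the Hilbert–Schmidt norm of `B` and `d` for a lower bound on the distance of
the spectra.

The integral is controlled by the measure `ν(S) = ‖E(S) C‖₂²`, finite with total mass `‖C‖₂²`.
Projections on disjoint sets have orthogonal ranges, so the integral of a step function has norm at
most its `L²(ν)` norm (`enorm_simpleIntegral_le`). Hence integrals of bounded continuous functions
exist, and `‖∫ E(dμ) C F‖ ≤ ‖C‖₂ sup ‖F‖`.

For μ in the spectrum of `A'`, self-adjointness of `A` gives `‖(A - μ)⁻¹‖ ≤ 1/d`. When `‖Q‖ ≤ δ`,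
the perturbation `B Q` has norm at most `bδ < d`, so `A + B Q - μ` has an inverse of norm at most `r
= 1/(d - bδ)`. The ball is preserved if `br ≤ δ`, which follows from `b(1 + δ²) < dδ`. By the
resolvent identity Φ has Lipschitz constant `(br)²`, and `br < 1` means `b(1 + δ) < d`. These are
the two terms of the minimum.

The third claim is immediate: (*) says that the integral in `V(A + B Q)` is `Q`. -/

noncomputable section

/-! ### Hilbert–Schmidt norm: adjoint and domination of the operator norm -/

section HilbertSchmidtBounds

variable {E : Type*} {F : Type*}
  [NormedAddCommGroup E] [InnerProductSpace ℂ E] [CompleteSpace E]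
  [NormedAddCommGroup F] [InnerProductSpace ℂ F] [CompleteSpace F]

theorem hsNorm_sq_eq {ι : Type*} (b : HilbertBasis ι ℂ E) (T : E →L[ℂ] F) :
    hsNorm T ^ 2 = ∑' i, ‖T (b i)‖ₑ ^ 2 := by
  rw [hsNorm_eq b, ← ENNReal.rpow_natCast, ← ENNReal.rpow_mul]
  norm_num

theorem hsNorm_adjoint (T : E →L[ℂ] F) : hsNorm (ContinuousLinearMap.adjoint T) = hsNorm T := by
  obtain ⟨_, b, -⟩ := exists_hilbertBasis ℂ E
  obtain ⟨_, f, -⟩ := exists_hilbertBasis ℂ F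
  rw [hsNorm_eq b T, hsNorm_eq f, tsum_enorm_sq_eq_adjoint b f T]

/-- Parseval for `T x` in a basis `f` of `F`, then Cauchy–Schwarz on each coefficient `⟪T* f j, x⟫`.
-/
theorem enorm_apply_le_hsNorm (T : E →L[ℂ] F) (x : E) : ‖T x‖ₑ ≤ hsNorm T * ‖x‖ₑ := by
  obtain ⟨_, f, -⟩ := exists_hilbertBasis ℂ F
  refine (ENNReal.pow_right_strictMono two_ne_zero).le_iff_le.1 ?_
  rw [mul_pow, ← f.tsum_enorm_inner_sq, ← hsNorm_adjoint, hsNorm_sq_eq f, ← ENNReal.tsum_mul_right]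
  refine ENNReal.tsum_le_tsum fun j => ?_
  rw [← mul_pow, ← ContinuousLinearMap.adjoint_inner_left]
  gcongr
  have := norm_inner_le_norm (𝕜 := ℂ) (ContinuousLinearMap.adjoint T (f j)) x
  rw [enorm_eq_nnnorm, enorm_eq_nnnorm, enorm_eq_nnnorm]
  exact_mod_cast this

end HilbertSchmidtBounds

/-! ### Orthogonality and the operator-valued spectral integral -/

theorem norm_sum_sq_of_pairwise_inner_eq_zero {K ι : Type*} [NormedAddCommGroup K]
    [InnerProductSpace ℂ K] (s : Finset ι) (v : ι → K)
    (h : ∀ i j, i ≠ j → ⟪v i, v j⟫_ℂ = 0) : ‖∑ i ∈ s, v i‖ ^ 2 = ∑ i ∈ s, ‖v i‖ ^ 2 := by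
  classical
  induction s using Finset.induction_on with
  | empty => simp
  | insert a s ha ih =>
    rw [Finset.sum_insert ha, Finset.sum_insert ha, ← ih]
    have : ⟪v a, ∑ i ∈ s, v i⟫_ℂ = 0 := by
      rw [inner_sum]
      exact Finset.sum_eq_zero fun i hi => h _ _ fun h => ha (h ▸ hi)
    simpa only [pow_two] using norm_add_sq_eq_norm_sq_add_norm_sq_of_inner_eq_zero _ _ this

section SpectralIntegral

variable {H : Type*} {K : Type*}
  [NormedAddCommGroup H] [InnerProductSpace ℂ H]
  [NormedAddCommGroup K] [InnerProductSpace ℂ K] [CompleteSpace K]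

namespace ProjMeasure

theorem union (E : ProjMeasure K) {S T : Set ℝ} (hS : MeasurableSet S) (hT : MeasurableSet T)
    (hd : Disjoint S T) : E.toFun (S ∪ T) = E.toFun S + E.toFun T := by
  ext x
  have h := E.hasSum_iUnion (fun n => if n = 0 then S else if n = 1 then T else ∅)
    (fun n => by split_ifs <;> simp [hS, hT])
    (fun m n hmn => by
      simp only [Function.onFun]
      split_ifs <;> simp_all [hd.symm]) x
  have hU : (⋃ n : ℕ, if n = 0 then S else if n = 1 then T else ∅) = S ∪ T := by
    ext t
    simp only [Set.mem_iUnion, Set.mem_union]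
    constructor
    · rintro ⟨n, hn⟩
      split_ifs at hn <;> simp_all
    · rintro (h | h)
      · exact ⟨0, by simpa using h⟩
      · exact ⟨1, by simpa using h⟩
  rw [hU] at h
  refine h.unique ?_
  have h2 := hasSum_sum_of_ne_finset_zero (L := .unconditional ℕ) (s := Finset.range 2)
    (f := fun n => E.toFun (if n = 0 then S else if n = 1 then T else ∅) x) (by
      intro n hn
      have h0 : n ≠ 0 := by rintro rfl; simp at hn
      have h1 : n ≠ 1 := by rintro rfl; simp at hn
      simp [h0, h1, E.empty])
  simpa [Finset.sum_range_succ] using h2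

theorem inner_eq_zero_of_disjoint (E : ProjMeasure K) {S T : Set ℝ} (hS : MeasurableSet S)
    (hT : MeasurableSet T) (hd : Disjoint S T) (x y : K) : ⟪E.toFun S x, E.toFun T y⟫_ℂ = 0 := by
  have h2 : ContinuousLinearMap.adjoint (E.toFun S) = E.toFun S :=
    (E.isStarProjection S hS).isSelfAdjoint
  have h3 : E.toFun S (E.toFun T y) = 0 := by
    have := congrArg (fun L : K →L[ℂ] K => L y) (E.inter S T hS hT)
    rw [hd.inter_eq, E.empty] at this
    simpa using this.symm
  rw [← ContinuousLinearMap.adjoint_inner_right, h2, h3, inner_zero_right]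

end ProjMeasure

theorem simpleIntegral_sub (E : ProjMeasure K) {σ : Set ℝ} (hσ : MeasurableSet σ) (C : H →L[ℂ] K)
    (φ ψ : SimpleFunc ℝ (H →L[ℂ] H)) :
    simpleIntegral E σ C (φ - ψ) = simpleIntegral E σ C φ - simpleIntegral E σ C ψ := by
  let T : Set ℝ → (H →L[ℂ] H) →L[ℝ] (H →L[ℂ] K) := fun S =>
    (ContinuousLinearMap.compL ℂ H H K (E.toFun (S ∩ σ) ∘L C)).restrictScalars ℝ
  -- Only finite additivity of `T` matters; the zero measure makes every integrability condition
  -- trivial.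
  have hT : FinMeasAdditive (0 : Measure ℝ) T := by
    intro s t hs ht _ _ hd
    ext L x
    simp [T, Set.union_inter_distrib_right, E.union (hs.inter hσ) (ht.inter hσ)
      (hd.mono Set.inter_subset_left Set.inter_subset_left)]
  have h : ∀ φ, simpleIntegral E σ C φ = SimpleFunc.setToSimpleFunc T φ := fun φ => rfl
  rw [h, h, h]
  exact SimpleFunc.setToSimpleFunc_sub T hT (integrable_zero_measure) (integrable_zero_measure)

section

variable {E : ProjMeasure K} {σ : Set ℝ} {C : H →L[ℂ] K}

theorem aestronglyMeasurable_of_simpleFunc_tendsto (hσ : MeasurableSet σ) {ν : Measure ℝ}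
    {φ : ℕ → SimpleFunc ℝ (H →L[ℂ] H)} {F : ℝ → H →L[ℂ] H}
    (hlim : ∀ μ ∈ σ, Tendsto (fun n => φ n μ) atTop (𝓝 (F μ))) :
    AEStronglyMeasurable F (ν.restrict σ) :=
  aestronglyMeasurable_of_tendsto_ae atTop (fun n => (φ n).aestronglyMeasurable)
    (ae_restrict_of_forall_mem hσ hlim)

theorem hasSpectralIntegral_zero : HasSpectralIntegral E σ C 0 0 :=
  ⟨fun _ => 0, ⟨0, by simp⟩, by simp, by simp [simpleIntegral]⟩

theorem hasSpectralIntegral_spectralIntegral {F : ℝ → H →L[ℂ] H}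
    (h : ∃ J, HasSpectralIntegral E σ C F J) :
    HasSpectralIntegral E σ C F (spectralIntegral E σ C F) := by
  rw [spectralIntegral, dif_pos h]
  exact h.choose_spec

end

variable [CompleteSpace H]

namespace ProjMeasure

/-- The measure `S ↦ ‖E(S) C‖ ^ 2` in the Hilbert-Schmidt norm. -/
def hsMeasure (E : ProjMeasure K) (C : H →L[ℂ] K) : Measure ℝ :=
  Measure.sum fun e : (exists_hilbertBasis ℂ H).choose => E.scalar (C (e : H))

theorem hsMeasure_apply (E : ProjMeasure K) (C : H →L[ℂ] K) {S : Set ℝ} (hS : MeasurableSet S) :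
    E.hsMeasure C S = hsNorm (E.toFun S ∘L C) ^ 2 := by
  rw [hsMeasure, Measure.sum_apply _ hS, hsNorm, ← ENNReal.rpow_natCast, ← ENNReal.rpow_mul]
  norm_num
  simp [E.scalar_apply _ hS]

theorem hsMeasure_univ (E : ProjMeasure K) (C : H →L[ℂ] K) :
    E.hsMeasure C Set.univ = hsNorm C ^ 2 := by
  rw [hsMeasure_apply _ _ MeasurableSet.univ, E.univ]
  rfl

theorem isFiniteMeasure_hsMeasure (E : ProjMeasure K) {C : H →L[ℂ] K} (hC : hsNorm C ≠ ∞) :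
    IsFiniteMeasure (E.hsMeasure C) :=
  ⟨by rw [hsMeasure_univ]; exact (ENNReal.pow_ne_top hC).lt_top⟩

end ProjMeasure

/-- The terms `E(Sₖ) C Tₖ x` are mutually orthogonal, so their squared norms add up, and each is at
most `‖E(Sₖ) C‖₂² ‖Tₖ‖² ‖x‖²`. The Hilbert–Schmidt norm is needed because its square, unlike that of
the operator norm, is additive in `S`. -/
theorem enorm_simpleIntegral_le (E : ProjMeasure K) {σ : Set ℝ} (hσ : MeasurableSet σ)
    (C : H →L[ℂ] K) (φ : SimpleFunc ℝ (H →L[ℂ] H)) :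
    ‖simpleIntegral E σ C φ‖ₑ ≤ eLpNorm φ 2 ((E.hsMeasure C).restrict σ) := by
  have hint : eLpNorm φ 2 ((E.hsMeasure C).restrict σ) ^ 2
      = ∑ T ∈ φ.range, ‖T‖ₑ ^ 2 * hsNorm (E.toFun (φ ⁻¹' {T} ∩ σ) ∘L C) ^ 2 := by
    rw [eLpNorm_eq_lintegral_rpow_enorm_toReal two_ne_zero ENNReal.ofNat_ne_top,
      ← ENNReal.rpow_natCast, ← ENNReal.rpow_mul]
    have := SimpleFunc.map_lintegral (μ := (E.hsMeasure C).restrict σ)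
      (fun T : H →L[ℂ] H => ‖T‖ₑ ^ 2) φ
    rw [← SimpleFunc.lintegral_eq_lintegral] at this
    norm_num
    simp only [SimpleFunc.coe_map, Function.comp_apply] at this
    rw [this]
    refine Finset.sum_congr rfl fun T _ => ?_
    rw [Measure.restrict_apply (φ.measurableSet_fiber T),
      E.hsMeasure_apply C ((φ.measurableSet_fiber T).inter hσ)]
  have key : ∀ x, ‖simpleIntegral E σ C φ x‖ₑ ≤ eLpNorm φ 2 ((E.hsMeasure C).restrict σ) * ‖x‖ₑ := by
    intro x
    refine (ENNReal.pow_right_strictMono two_ne_zero).le_iff_le.1 ?_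
    have hpyth := norm_sum_sq_of_pairwise_inner_eq_zero φ.range
      (fun T => E.toFun (φ ⁻¹' {T} ∩ σ) (C (T x))) (by
        intro T T' hTT'
        refine E.inner_eq_zero_of_disjoint ((φ.measurableSet_fiber T).inter hσ)
          ((φ.measurableSet_fiber T').inter hσ) ?_ _ _
        refine Disjoint.mono Set.inter_subset_left Set.inter_subset_left ?_
        exact Disjoint.preimage _ (by simpa using hTT'))
    have hpyth' : ‖simpleIntegral E σ C φ x‖ₑ ^ 2
        = ∑ T ∈ φ.range, ‖E.toFun (φ ⁻¹' {T} ∩ σ) (C (T x))‖ₑ ^ 2 := by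
      have h1 : simpleIntegral E σ C φ x
          = ∑ T ∈ φ.range, E.toFun (φ ⁻¹' {T} ∩ σ) (C (T x)) := by
        simp [simpleIntegral]
      rw [h1]
      have := congrArg ENNReal.ofReal hpyth
      rw [ENNReal.ofReal_sum_of_nonneg (fun _ _ => sq_nonneg _)] at this
      simpa [ENNReal.ofReal_pow] using this
    rw [hpyth', mul_pow, hint, Finset.sum_mul]
    refine Finset.sum_le_sum fun T _ => ?_
    rw [← mul_pow, ← mul_pow]
    gcongr
    calc ‖E.toFun (φ ⁻¹' {T} ∩ σ) (C (T x))‖ₑ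
        ≤ hsNorm (E.toFun (φ ⁻¹' {T} ∩ σ) ∘L C) * ‖T x‖ₑ :=
          enorm_apply_le_hsNorm (E.toFun (φ ⁻¹' {T} ∩ σ) ∘L C) (T x)
      _ ≤ hsNorm (E.toFun (φ ⁻¹' {T} ∩ σ) ∘L C) * (‖T‖ₑ * ‖x‖ₑ) := by
          gcongr
          exact T.le_opENorm x
      _ = _ := by ring
  by_cases htop : eLpNorm φ 2 ((E.hsMeasure C).restrict σ) = ∞
  · simp [htop]
  refine (ENNReal.toReal_le_toReal enorm_ne_top htop).1 ?_
  rw [toReal_enorm]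
  refine ContinuousLinearMap.opNorm_le_bound _ ENNReal.toReal_nonneg fun x => ?_
  have := ENNReal.toReal_mono (ENNReal.mul_ne_top htop enorm_ne_top) (key x)
  simpa [ENNReal.toReal_mul] using this

/-- Dominated convergence in `L²` of a finite measure. -/
theorem tendsto_eLpNorm_two_sub {X G : Type*} [MeasurableSpace X] [NormedAddCommGroup G]
    {ν : Measure X} [IsFiniteMeasure ν] {f : ℕ → X → G} {g : X → G} {M : ℝ}
    (hf : ∀ n, AEStronglyMeasurable (f n) ν) (hM : ∀ n, ∀ᵐ x ∂ν, ‖f n x‖ ≤ M)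
    (hlim : ∀ᵐ x ∂ν, Tendsto (fun n => f n x) atTop (𝓝 (g x))) :
    Tendsto (fun n => eLpNorm (f n - g) 2 ν) atTop (𝓝 0) := by
  have hg : AEStronglyMeasurable g ν := aestronglyMeasurable_of_tendsto_ae atTop hf hlim
  have h := tendsto_lintegral_of_dominated_convergence' (μ := ν)
    (F := fun n x => ‖f n x - g x‖ₑ ^ 2) (f := fun _ => 0)
    -- The limit inherits the bound `M`, so the constant `(2M)²` dominates.
    (fun _ => ENNReal.ofReal (M + M) ^ 2) (fun n => (((hf n).sub hg).enorm).pow_const 2)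
    (fun n => by
      filter_upwards [ae_all_iff.2 hM, hlim] with x hx hl
      have h1 : ‖g x‖ ≤ M := le_of_tendsto hl.norm (Eventually.of_forall hx)
      gcongr
      rw [← ofReal_norm]
      exact ENNReal.ofReal_le_ofReal ((norm_sub_le _ _).trans (add_le_add (hx n) h1)))
    (by
      rw [lintegral_const]
      exact ENNReal.mul_ne_top (ENNReal.pow_ne_top ENNReal.ofReal_ne_top) (measure_ne_top _ _))
    (by
      filter_upwards [hlim] with x hl
      have h1 : Tendsto (fun n => f n x - g x) atTop (𝓝 0) := by
        simpa using hl.sub_const (g x)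
      have h2 := (ENNReal.continuous_pow 2).tendsto _ |>.comp h1.enorm
      simpa [Function.comp_def] using h2)
  have h2 := (ENNReal.continuous_rpow_const (y := 1 / 2)).tendsto _ |>.comp h
  simp only [lintegral_zero] at h2
  rw [ENNReal.zero_rpow_of_pos (by norm_num)] at h2
  refine h2.congr fun n => ?_
  rw [eLpNorm_eq_lintegral_rpow_enorm_toReal two_ne_zero ENNReal.ofNat_ne_top]
  simp

section

variable {E : ProjMeasure K} {σ : Set ℝ} {C : H →L[ℂ] K}

theorem tendsto_eLpNorm_hsMeasure (hσ : MeasurableSet σ) (hC : hsNorm C ≠ ∞)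
    {φ : ℕ → SimpleFunc ℝ (H →L[ℂ] H)} {F : ℝ → H →L[ℂ] H} {M : ℝ}
    (hM : ∀ n, ∀ μ ∈ σ, ‖φ n μ‖ ≤ M)
    (hlim : ∀ μ ∈ σ, Tendsto (fun n => φ n μ) atTop (𝓝 (F μ))) :
    Tendsto (fun n => eLpNorm (⇑(φ n) - F) 2 ((E.hsMeasure C).restrict σ)) atTop (𝓝 0) := by
  have := E.isFiniteMeasure_hsMeasure hC
  exact tendsto_eLpNorm_two_sub (fun n => (φ n).aestronglyMeasurable)
    (fun n => ae_restrict_of_forall_mem hσ (hM n)) (ae_restrict_of_forall_mem hσ hlim)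

/-- The step-function bound passes to the limit by the triangle inequality in `L²`. The case `F = G`
shows that the integral does not depend on the approximating sequence. -/
theorem HasSpectralIntegral.enorm_sub_le (hσ : MeasurableSet σ) (hC : hsNorm C ≠ ∞)
    {F G : ℝ → H →L[ℂ] H} {J J' : H →L[ℂ] K}
    (hJ : HasSpectralIntegral E σ C F J) (hJ' : HasSpectralIntegral E σ C G J') :
    ‖J - J'‖ₑ ≤ eLpNorm (F - G) 2 ((E.hsMeasure C).restrict σ) := by
  obtain ⟨φ, ⟨M, hM⟩, hφ, hφJ⟩ := hJ
  obtain ⟨ψ, ⟨M', hM'⟩, hψ, hψJ⟩ := hJ'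
  set ν := (E.hsMeasure C).restrict σ
  have hF : AEStronglyMeasurable F ν := aestronglyMeasurable_of_simpleFunc_tendsto hσ hφ
  have hG : AEStronglyMeasurable G ν := aestronglyMeasurable_of_simpleFunc_tendsto hσ hψ
  have h1 := tendsto_eLpNorm_hsMeasure (E := E) hσ hC hM hφ
  have h2 := tendsto_eLpNorm_hsMeasure (E := E) hσ hC hM' hψ
  have h3 : Tendsto (fun n => eLpNorm (⇑(φ n) - F) 2 ν + eLpNorm (⇑(ψ n) - G) 2 ν
      + eLpNorm (F - G) 2 ν) atTop (𝓝 (eLpNorm (F - G) 2 ν)) := by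
    simpa using (h1.add h2).add_const (eLpNorm (F - G) 2 ν)
  refine le_of_tendsto_of_tendsto' (hφJ.sub hψJ).enorm h3 fun n => ?_
  rw [← simpleIntegral_sub E hσ]
  refine (enorm_simpleIntegral_le E hσ C _).trans ?_
  have h4 : ((φ n - ψ n : SimpleFunc ℝ (H →L[ℂ] H)) : ℝ → H →L[ℂ] H)
      = ((⇑(φ n) - F) - (⇑(ψ n) - G)) + (F - G) := by
    rw [SimpleFunc.coe_sub]
    abel
  rw [h4]
  have m1 := (φ n).aestronglyMeasurable (μ := ν)
  have m2 := (ψ n).aestronglyMeasurable (μ := ν)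
  refine (eLpNorm_add_le ((m1.sub hF).sub (m2.sub hG)) (hF.sub hG) one_le_two).trans ?_
  gcongr
  exact eLpNorm_sub_le (m1.sub hF) (m2.sub hG) one_le_two

theorem HasSpectralIntegral.norm_sub_le (hσ : MeasurableSet σ) (hC : hsNorm C ≠ ∞)
    {F G : ℝ → H →L[ℂ] H} {J J' : H →L[ℂ] K}
    (hJ : HasSpectralIntegral E σ C F J) (hJ' : HasSpectralIntegral E σ C G J')
    {c : ℝ} (hc : 0 ≤ c) (hFG : ∀ μ ∈ σ, ‖F μ - G μ‖ ≤ c) :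
    ‖J - J'‖ ≤ c * (hsNorm C).toReal := by
  have h1 := hJ.enorm_sub_le hσ hC hJ'
  have h2 := eLpNorm_le_of_ae_bound (p := 2) (μ := (E.hsMeasure C).restrict σ) (f := F - G)
    (ae_restrict_of_forall_mem hσ hFG)
  have h3 : ((E.hsMeasure C).restrict σ) Set.univ ^ (2 : ℝ≥0∞).toReal⁻¹ ≤ hsNorm C := by
    calc ((E.hsMeasure C).restrict σ) Set.univ ^ (2 : ℝ≥0∞).toReal⁻¹
        ≤ (hsNorm C ^ 2) ^ (2 : ℝ≥0∞).toReal⁻¹ := by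
          refine ENNReal.rpow_le_rpow ?_ (by positivity)
          rw [← E.hsMeasure_univ]
          exact Measure.restrict_apply_le _ _
      _ = hsNorm C := by
          rw [← ENNReal.rpow_natCast, ← ENNReal.rpow_mul]
          norm_num
  have h4 : ‖J - J'‖ₑ ≤ ENNReal.ofReal c * hsNorm C := by
    refine (h1.trans h2).trans ?_
    rw [mul_comm]
    gcongr
  have h5 := ENNReal.toReal_mono (ENNReal.mul_ne_top ENNReal.ofReal_ne_top hC) h4
  simpa [ENNReal.toReal_mul, ENNReal.toReal_ofReal hc] using h5

theorem exists_hasSpectralIntegral (hσ : MeasurableSet σ) (hC : hsNorm C ≠ ∞)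
    {F : ℝ → H →L[ℂ] H} (hF : ContinuousOn F σ) {M : ℝ} (hM : ∀ μ ∈ σ, ‖F μ‖ ≤ M) :
    ∃ J, HasSpectralIntegral E σ C F J := by
  -- Operators on `H` need not form a separable space; strong measurability comes from continuity on
  -- the separable set `σ`.
  obtain ⟨G, hG, hGF⟩ : ∃ G : ℝ → H →L[ℂ] H, StronglyMeasurable G ∧ ∀ μ ∈ σ, G μ = F μ := by
    obtain ⟨G, hG, h⟩ := (MeasurableEmbedding.subtype_coe hσ).exists_stronglyMeasurable_extend
      (continuousOn_iff_continuous_domRestrict.1 hF).stronglyMeasurable (fun _ => ⟨0⟩)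
    exact ⟨G, hG, fun μ hμ => congrFun h ⟨μ, hμ⟩⟩
  -- `M` may be negative when `σ` is empty.
  have hb : ∀ n, ∀ μ ∈ σ, ‖hG.approxBounded (max M 0) n μ‖ ≤ max M 0 := fun n μ _ =>
    hG.norm_approxBounded_le (le_max_right _ _) n μ
  have hlim : ∀ μ ∈ σ, Tendsto (fun n => hG.approxBounded (max M 0) n μ) atTop (𝓝 (F μ)) := by
    intro μ hμ
    rw [← hGF μ hμ]
    refine hG.tendsto_approxBounded_of_norm_le ?_
    rw [hGF μ hμ]
    exact (hM μ hμ).trans (le_max_left _ _)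
  set φ := hG.approxBounded (max M 0)
  have hcauchy : CauchySeq fun n => simpleIntegral E σ C (φ n) := by
    have ht := tendsto_eLpNorm_hsMeasure (E := E) hσ hC hb hlim
    set ν := (E.hsMeasure C).restrict σ
    have hFm : AEStronglyMeasurable F ν := aestronglyMeasurable_of_simpleFunc_tendsto hσ hlim
    rw [Metric.cauchySeq_iff']
    intro ε hε
    have hε' : (0 : ℝ≥0∞) < ENNReal.ofReal (ε / 2) := by simpa using hε
    obtain ⟨N, hN⟩ := eventually_atTop.1 (ht.eventually_lt_const hε')
    refine ⟨N, fun n hn => ?_⟩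
    rw [dist_eq_norm, ← simpleIntegral_sub E hσ]
    have h4 : ((φ n - φ N : SimpleFunc ℝ (H →L[ℂ] H)) : ℝ → H →L[ℂ] H)
        = (⇑(φ n) - F) - (⇑(φ N) - F) := by
      rw [SimpleFunc.coe_sub]
      abel
    have h5 : ‖simpleIntegral E σ C (φ n - φ N)‖ₑ < ENNReal.ofReal ε := by
      refine (enorm_simpleIntegral_le E hσ C _).trans_lt ?_
      rw [h4]
      refine (eLpNorm_sub_le ((φ n).aestronglyMeasurable.sub hFm)
        ((φ N).aestronglyMeasurable.sub hFm) one_le_two).trans_lt ?_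
      refine (ENNReal.add_lt_add (hN n hn) (hN N le_rfl)).trans_eq ?_
      rw [← ENNReal.ofReal_add (by positivity) (by positivity), add_halves]
    rw [← ofReal_norm] at h5
    exact (ENNReal.ofReal_lt_ofReal_iff hε).1 h5
  obtain ⟨J, hJ⟩ := cauchySeq_tendsto_of_complete hcauchy
  exact ⟨J, φ, ⟨_, hb⟩, hlim, hJ⟩

end

end SpectralIntegral

/-! ### Resolvents of unbounded operators under bounded perturbation -/

section ResolventLemmas

variable {H : Type*} [NormedAddCommGroup H] [InnerProductSpace ℂ H]
  {A : H →ₗ.[ℂ] H} {W W' : H →L[ℂ] H} {z z' : ℂ} {R S : H →L[ℂ] H}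

theorem isResolventAt_opResolvent (h : z ∈ opResolventSet A) :
    IsResolventAt A z (opResolvent A z) := by
  have h' : ∃ R, IsResolventAt A z R := h
  rw [opResolvent, dif_pos h']
  exact h'.choose_spec

theorem addBounded_zero (A : H →ₗ.[ℂ] H) : addBounded A 0 = A :=
  zero_vadd (H →ₗ[ℂ] H) A

theorem isResolventAt_addBounded_iff :
    IsResolventAt (addBounded A W) z S ↔
      (∀ x : H, ∃ h : S x ∈ A.domain, W (S x) + A ⟨S x, h⟩ - z • S x = x) ∧
        ∀ x : A.domain, S (W x + A x - z • (x : H)) = x :=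
  Iff.rfl

/-- Both resolvent identities at once: apply `S` to `x - (A + W - z) R x`, after rewriting `x` as
`(A + W' - z') R x`. -/
theorem IsResolventAt.sub_eq (hS : IsResolventAt (addBounded A W) z S)
    (hR : IsResolventAt (addBounded A W') z' R) :
    S - R = S ∘L (W' - W + (z - z') • (1 : H →L[ℂ] H)) ∘L R := by
  rw [isResolventAt_addBounded_iff] at hS hR
  ext x
  obtain ⟨h, hx⟩ := hR.1 x
  have h1 := hS.2 ⟨R x, h⟩
  dsimp only at h1
  have h2 : (W' - W + (z - z') • (1 : H →L[ℂ] H)) (R x)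
      = x - (W (R x) + A ⟨R x, h⟩ - z • R x) := by
    conv_rhs => enter [1]; rw [← hx]
    simp only [add_apply, sub_apply,
      smul_apply, one_apply_eq_self, sub_smul]
    abel
  simp only [ContinuousLinearMap.comp_apply, sub_apply] at h2 ⊢
  rw [h2, map_sub, h1]

theorem IsResolventAt.sub_eq_smul (hS : IsResolventAt A z S) (hR : IsResolventAt A z' R) :
    S - R = (z - z') • (S * R) := by
  rw [← addBounded_zero A] at hS hR
  rw [hS.sub_eq hR]
  ext x
  simp

theorem IsResolventAt.sub_eq_of_addBounded (hS : IsResolventAt (addBounded A W) z S)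
    (hR : IsResolventAt (addBounded A W') z R) : S - R = S ∘L (W' - W) ∘L R := by
  simpa using hS.sub_eq hR

theorem norm_comp_comp_le (S T R : H →L[ℂ] H) : ‖S ∘L T ∘L R‖ ≤ ‖S‖ * (‖T‖ * ‖R‖) :=
  (S.opNorm_comp_le _).trans (by gcongr; exact T.opNorm_comp_le R)

/-- The Neumann series bound for the resolvent of `A + W`. -/
theorem IsResolventAt.norm_le_of_addBounded (hR : IsResolventAt A z R)
    (hS : IsResolventAt (addBounded A W) z S) {d w : ℝ} (hd : 0 < d) (hw : w < d)
    (hRd : ‖R‖ ≤ d⁻¹) (hW : ‖W‖ ≤ w) : ‖S‖ ≤ (d - w)⁻¹ := by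
  rw [← addBounded_zero A] at hR
  have h1 : ‖S - R‖ ≤ ‖S‖ * (w * d⁻¹) := by
    rw [hS.sub_eq_of_addBounded hR]
    refine (norm_comp_comp_le _ _ _).trans ?_
    rw [zero_sub, norm_neg]
    have hw0 := (norm_nonneg W).trans hW
    gcongr
  have h2 : ‖S‖ ≤ ‖S - R‖ + ‖R‖ := by simpa using norm_add_le (S - R) R
  have h3 : ‖S‖ ≤ ‖S‖ * (w * d⁻¹) + d⁻¹ := by linarith
  have h4 : ‖S‖ * d ≤ ‖S‖ * w + 1 := by
    have := mul_le_mul_of_nonneg_right h3 hd.le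
    field_simp at this
    linarith
  rw [inv_eq_one_div, le_div_iff₀ (by linarith)]
  linarith

/-- If `S` were the resolvent at `z + r⁻¹`, the first resolvent identity would make `r⁻¹(1 + r⁻¹ S)`
an inverse of `r - R`. -/
theorem IsResolventAt.mem_opSpectrum_of_mem_spectrum (hR : IsResolventAt A z R) {r : ℂ}
    (hr : r ∈ spectrum ℂ R) (hr0 : r ≠ 0) : z + r⁻¹ ∈ opSpectrum A := by
  rintro ⟨S, hS⟩
  refine (spectrum.mem_iff.1 hr) ?_
  have h1 := hS.sub_eq_smul hR
  have h2 := hR.sub_eq_smul hS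
  rw [add_sub_cancel_left] at h1
  rw [sub_add_cancel_left, neg_smul] at h2
  have h3 : S = R + r⁻¹ • (S * R) := by rw [← h1]; abel
  have h4 : S = R + r⁻¹ • (R * S) := by rw [← neg_neg (r⁻¹ • (R * S)), ← h2]; abel
  have e1 : r⁻¹ * r⁻¹ * r = r⁻¹ := by field_simp
  have e2 : r * (r⁻¹ * r⁻¹) = r⁻¹ := by field_simp
  rw [Algebra.algebraMap_eq_smul_one]
  refine ⟨⟨_, r⁻¹ • (1 + r⁻¹ • S), ?_, ?_⟩, rfl⟩
  · have : (r • (1 : H →L[ℂ] H) - R) * (r⁻¹ • (1 + r⁻¹ • S))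
        = (1 : H →L[ℂ] H) + r⁻¹ • (S - (R + r⁻¹ • (R * S))) := by
      simp only [sub_mul, mul_add, mul_smul_comm, smul_mul_assoc, one_mul, mul_one, smul_sub,
        smul_add, smul_smul, inv_mul_cancel₀ hr0, e1, one_smul]
      abel
    rw [this, ← h4, sub_self, smul_zero, add_zero]
  · have : (r⁻¹ • (1 + r⁻¹ • S)) * (r • (1 : H →L[ℂ] H) - R)
        = (1 : H →L[ℂ] H) + r⁻¹ • (S - (R + r⁻¹ • (S * R))) := by
      simp only [mul_sub, add_mul, mul_smul_comm, smul_mul_assoc, one_mul, mul_one, smul_sub,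
        smul_add, smul_smul, mul_inv_cancel₀ hr0, e2, one_smul]
      abel
    rw [this, ← h3, sub_self, smul_zero, add_zero]

variable [CompleteSpace H]

/-- Factor `A + W - z = (1 + W R)(A - z)` and invert the first factor by a Neumann series. -/
theorem IsResolventAt.mem_opResolventSet_addBounded (hR : IsResolventAt A z R)
    (h : ‖W‖ * ‖R‖ < 1) : z ∈ opResolventSet (addBounded A W) := by
  obtain ⟨U, V, hU, hUV, hVU⟩ : ∃ U V : H →L[ℂ] H, U = 1 + W * R ∧ U * V = 1 ∧ V * U = 1 :=
    ⟨Units.oneSub (-(W * R)) (by rw [norm_neg]; exact (norm_mul_le _ _).trans_lt h),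
      _, by simp, Units.mul_inv _, Units.inv_mul _⟩
  have hU1 : ∀ x, U (V x) = x := fun x => congrArg (fun T : H →L[ℂ] H => T x) hUV
  have hU2 : ∀ x, V (U x) = x := fun x => congrArg (fun T : H →L[ℂ] H => T x) hVU
  refine ⟨R * V, isResolventAt_addBounded_iff.2 ⟨fun x => ?_, fun x => ?_⟩⟩
  · obtain ⟨hx, hx'⟩ := hR.1 (V x)
    refine ⟨hx, ?_⟩
    have h1 := hU1 x
    rw [hU] at h1
    simp only [add_apply, one_apply_eq_self, mul_apply_eq_comp] at h1 ⊢
    rw [add_sub_assoc, hx', add_comm, h1]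
  · have h1 := hR.2 x
    have h2 : W x + A x - z • (x : H) = U (A x - z • (x : H)) := by
      rw [hU]
      simp only [add_apply, one_apply_eq_self, mul_apply_eq_comp, h1]
      abel
    rw [mul_apply_eq_comp, h2, hU2, h1]

theorem isOpen_opResolventSet (A : H →ₗ.[ℂ] H) : IsOpen (opResolventSet A) := by
  rw [Metric.isOpen_iff]
  rintro z ⟨R, hR⟩
  refine ⟨(‖R‖ + 1)⁻¹, by positivity, fun w hw => ?_⟩
  -- Moving the point from `z` to `w` amounts to perturbing `A` by the scalar `z - w`.
  have h1 : ‖(z - w) • (1 : H →L[ℂ] H)‖ * ‖R‖ < 1 := by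
    have h2 : ‖z - w‖ < (‖R‖ + 1)⁻¹ := by
      rwa [← dist_eq_norm, dist_comm]
    calc ‖(z - w) • (1 : H →L[ℂ] H)‖ * ‖R‖ ≤ (‖R‖ + 1)⁻¹ * ‖R‖ := by
          gcongr
          refine (norm_smul_le _ _).trans ?_
          calc ‖z - w‖ * ‖(1 : H →L[ℂ] H)‖ ≤ ‖z - w‖ * 1 := by
                gcongr
                exact ContinuousLinearMap.norm_id_le
            _ ≤ _ := by linarith
      _ < 1 := by
          rw [inv_mul_eq_div, div_lt_one (by positivity)]
          linarith
  obtain ⟨S, hS⟩ := hR.mem_opResolventSet_addBounded h1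
  rw [isResolventAt_addBounded_iff] at hS
  have key : ∀ x y : H, ((z - w) • (1 : H →L[ℂ] H)) x + y - z • x = y - w • x := by
    intro x y
    rw [smul_apply, one_apply_eq_self, sub_smul]
    abel
  simp only [key] at hS
  exact ⟨S, hS⟩

theorem isClosed_realSpectrum (A : H →ₗ.[ℂ] H) : IsClosed (realSpectrum A) :=
  (isOpen_opResolventSet A).isClosed_compl.preimage Complex.continuous_ofReal

theorem IsResolventAt.isSelfAdjoint (hA : IsSelfAdjoint A) {μ : ℝ} (hR : IsResolventAt A μ R) :
    IsSelfAdjoint R := by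
  rw [ContinuousLinearMap.isSelfAdjoint_iff']
  refine (ContinuousLinearMap.eq_adjoint_iff _ _).2 (fun x y => ?_) |>.symm
  obtain ⟨hx, hx'⟩ := hR.1 x
  obtain ⟨hy, hy'⟩ := hR.1 y
  have hsymm : A.IsFormalAdjoint A := by
    have := A.adjoint_isFormalAdjoint hA.dense_domain
    rwa [LinearPMap.isSelfAdjoint_def.1 hA] at this
  have h1 : ⟪A ⟨R x, hx⟩, R y⟫_ℂ = ⟪R x, A ⟨R y, hy⟩⟫_ℂ := hsymm ⟨R x, hx⟩ ⟨R y, hy⟩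
  conv_lhs => rw [← hy']
  conv_rhs => rw [← hx']
  rw [inner_sub_left, inner_sub_right, h1, inner_smul_left, inner_smul_right, Complex.conj_ofReal]

/-- The resolvent of a self-adjoint operator at a real point is bounded by the inverse distance
to the spectrum. -/
theorem IsResolventAt.norm_le_inv_dist (hA : IsSelfAdjoint A) {μ d : ℝ} (hR : IsResolventAt A μ R)
    (hd : 0 < d) (h : ∀ w ∈ opSpectrum A, d ≤ dist w μ) : ‖R‖ ≤ d⁻¹ := by
  -- The norm of the bounded self-adjoint `R` is its spectral radius, and each nonzero `r` in its
  -- spectrum gives the point `μ + r⁻¹` of the spectrum of `A`, whence `|r|⁻¹ ≥ d`.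
  have h1 := (hR.isSelfAdjoint hA).spectralRadius_eq_nnnorm
  have h2 : spectralRadius ℂ R ≤ ENNReal.ofReal d⁻¹ := by
    refine iSup₂_le fun r hr => ?_
    rw [← enorm_eq_nnnorm, ← ofReal_norm]
    refine ENNReal.ofReal_le_ofReal ?_
    by_cases hr0 : r = 0
    · simpa [hr0] using hd.le
    have h3 := h _ (hR.mem_opSpectrum_of_mem_spectrum hr hr0)
    rw [dist_eq_norm, add_sub_cancel_left, norm_inv] at h3
    exact le_inv_of_le_inv₀ hd h3
  rw [h1, ← enorm_eq_nnnorm, ← ofReal_norm] at h2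
  exact (ENNReal.ofReal_le_ofReal_iff (by positivity)).1 h2

end ResolventLemmas

/-! ### The fixed-point argument -/

section NonlinearEquation

variable {H K : Type*}
  [NormedAddCommGroup H] [InnerProductSpace ℂ H]
  [NormedAddCommGroup K] [InnerProductSpace ℂ K]
  {A : H →ₗ.[ℂ] H} {A' : K →ₗ.[ℂ] K}

theorem SolvesQEquation.solvesBasicEquation [CompleteSpace H] [CompleteSpace K]
    {E : ProjMeasure K} {B : K →L[ℂ] H} {Q : H →L[ℂ] K} (h : SolvesQEquation A A' E B Q) :
    SolvesBasicEquation A A' E B (addBounded A (B ∘L Q)) := by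
  refine ⟨h.1, ?_⟩
  rw [potential, ← h.2]

theorem continuousOn_opResolvent {Y : H →ₗ.[ℂ] H} {σ : Set ℝ} {M : ℝ}
    (hσ : ∀ μ ∈ σ, (μ : ℂ) ∈ opResolventSet Y) (hM : ∀ μ ∈ σ, ‖opResolvent Y μ‖ ≤ M) :
    ContinuousOn (fun μ : ℝ => opResolvent Y μ) σ := by
  -- The first resolvent identity gives the Lipschitz constant `M²`.
  refine (LipschitzOnWith.of_dist_le_mul (K := (M ^ 2).toNNReal) fun μ hμ ν hν => ?_).continuousOn
  rw [dist_eq_norm, Real.coe_toNNReal _ (sq_nonneg M),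
    (isResolventAt_opResolvent (hσ μ hμ)).sub_eq_smul (isResolventAt_opResolvent (hσ ν hν)),
    norm_smul, ← Complex.ofReal_sub, Complex.norm_real, ← dist_eq_norm, mul_comm]
  have hM0 := (norm_nonneg _).trans (hM μ hμ)
  gcongr
  rw [pow_two]
  exact (norm_mul_le _ _).trans (mul_le_mul (hM μ hμ) (hM ν hν) (norm_nonneg _) hM0)

/-- The distance is `∞` when a spectrum is empty; any sufficiently large real `d` then serves. -/
theorem exists_real_le_specDist (A : H →ₗ.[ℂ] H) (A' : K →ₗ.[ℂ] K) {t : ℝ≥0∞} {m : ℝ}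
    (hm : 0 < m) (h : t < specDist A A' * ENNReal.ofReal m) :
    ∃ d : ℝ, t.toReal < d * m ∧
      ∀ z ∈ opSpectrum A, ∀ w ∈ opSpectrum A', d ≤ dist z w := by
  have ht : t ≠ ∞ := h.ne_top
  obtain ⟨d, hd, htd⟩ : ∃ d : ℝ, ENNReal.ofReal d ≤ specDist A A' ∧ t.toReal < d * m := by
    by_cases htop : specDist A A' = ∞
    · exact ⟨t.toReal / m + 1, by simp [htop], by field_simp; linarith⟩
    · refine ⟨(specDist A A').toReal, by rw [ENNReal.ofReal_toReal htop], ?_⟩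
      have := (ENNReal.toReal_lt_toReal ht (ENNReal.mul_ne_top htop ENNReal.ofReal_ne_top)).2 h
      simpa [ENNReal.toReal_mul, ENNReal.toReal_ofReal hm.le] using this
  refine ⟨d, htd, fun z hz w hw => ?_⟩
  have h1 : specDist A A' ≤ edist z w :=
    (iInf₂_le z hz).trans (iInf₂_le (f := fun w (_ : w ∈ opSpectrum A') => edist z w) w hw)
  have h2 := hd.trans h1
  rw [edist_dist] at h2
  exact (ENNReal.ofReal_le_ofReal_iff dist_nonneg).1 h2

variable [CompleteSpace H] [CompleteSpace K]

theorem norm_le_toReal_hsNorm {B : K →L[ℂ] H} (hB : hsNorm B ≠ ∞) : ‖B‖ ≤ (hsNorm B).toReal := by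
  refine B.opNorm_le_bound ENNReal.toReal_nonneg fun x => ?_
  have := ENNReal.toReal_mono (ENNReal.mul_ne_top hB enorm_ne_top) (enorm_apply_le_hsNorm B x)
  simpa [ENNReal.toReal_mul] using this

/-- Resolvents of `A + W` for a self-adjoint `A` and small `W`, away from the spectrum of `A`. -/
theorem mem_opResolventSet_and_norm_le (hA : IsSelfAdjoint A) {W : H →L[ℂ] H} {d w μ : ℝ}
    (hW : ‖W‖ ≤ w) (hwd : w < d) (hμ : ∀ z ∈ opSpectrum A, d ≤ dist z μ) :
    (μ : ℂ) ∈ opResolventSet (addBounded A W) ∧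
      ‖opResolvent (addBounded A W) μ‖ ≤ (d - w)⁻¹ := by
  have hd : 0 < d := ((norm_nonneg W).trans hW).trans_lt hwd
  have hmem : (μ : ℂ) ∈ opResolventSet A := by
    by_contra h
    have := hμ μ h
    rw [dist_self] at this
    linarith
  obtain ⟨R, hR⟩ := hmem
  have hRd := hR.norm_le_inv_dist hA hd hμ
  have h1 : ‖W‖ * ‖R‖ < 1 := by
    calc ‖W‖ * ‖R‖ ≤ w * d⁻¹ := by
          have := (norm_nonneg W).trans hW
          gcongr
      _ < 1 := by rw [mul_inv_lt_iff₀ hd]; linarith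
  have h2 := hR.mem_opResolventSet_addBounded h1
  exact ⟨h2, hR.norm_le_of_addBounded (isResolventAt_opResolvent h2) hd hwd hRd hW⟩

theorem existsUnique_solvesQEquation (hA : IsSelfAdjoint A) (E : ProjMeasure K) (B : K →L[ℂ] H)
    {δ : ℝ} (hδ : 0 < δ)
    (h : hsNorm B < specDist A A' * ENNReal.ofReal (min (1 / (1 + δ)) (δ / (1 + δ ^ 2)))) :
    ∃! Q : H →L[ℂ] K, ‖Q‖ ≤ δ ∧ SolvesQEquation A A' E B Q := by
  obtain ⟨d, hbd, hdist⟩ := exists_real_le_specDist A A' (by positivity) h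
  have hB : hsNorm B ≠ ∞ := h.ne_top
  set b := (hsNorm B).toReal
  have hb0 : 0 ≤ b := ENNReal.toReal_nonneg
  have hd0 : 0 < d := pos_of_mul_pos_left (hb0.trans_lt hbd) (by positivity)
  -- The first term of the minimum: `b(1 + δ) < d`.
  have hb1 : b * δ < d - b := by
    have h1 := hbd.trans_le (mul_le_mul_of_nonneg_left (min_le_left _ _) hd0.le)
    rw [mul_one_div, lt_div_iff₀ (by positivity)] at h1
    linarith
  -- The second term: `b(1 + δ²) < dδ`, that is, `b < δ(d - bδ)`.
  have hb2 : b * (d - b * δ)⁻¹ ≤ δ := by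
    have h1 := hbd.trans_le (mul_le_mul_of_nonneg_left (min_le_right _ _) hd0.le)
    rw [← mul_div_assoc, lt_div_iff₀ (by positivity)] at h1
    rw [mul_inv_le_iff₀ (by linarith)]
    nlinarith
  set r := (d - b * δ)⁻¹
  have hr0 : 0 ≤ r := inv_nonneg.2 (by linarith)
  have hbr : b * r < 1 := by
    rw [mul_inv_lt_iff₀ (by linarith)]
    linarith
  set σ := realSpectrum A'
  have hσ : MeasurableSet σ := (isClosed_realSpectrum A').measurableSet
  set C := ContinuousLinearMap.adjoint B
  have hCb : hsNorm C = hsNorm B := hsNorm_adjoint B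
  have hC : hsNorm C ≠ ∞ := hCb ▸ hB
  have hBQ : ∀ Q : H →L[ℂ] K, ‖Q‖ ≤ δ → ‖B ∘L Q‖ ≤ b * δ := fun Q hQ =>
    (B.opNorm_comp_le Q).trans (mul_le_mul (norm_le_toReal_hsNorm hB) hQ (norm_nonneg _) hb0)
  have hres : ∀ Q : H →L[ℂ] K, ‖Q‖ ≤ δ → ∀ μ ∈ σ,
      (μ : ℂ) ∈ opResolventSet (addBounded A (B ∘L Q)) ∧
        ‖opResolvent (addBounded A (B ∘L Q)) μ‖ ≤ r := fun Q hQ μ hμ =>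
    mem_opResolventSet_and_norm_le hA (hBQ Q hQ) (by linarith) fun z hz => hdist z hz μ hμ
  let Φ : (H →L[ℂ] K) → (H →L[ℂ] K) := fun Q =>
    spectralIntegral E σ C fun μ => opResolvent (addBounded A (B ∘L Q)) μ
  have hex : ∀ Q : H →L[ℂ] K, ‖Q‖ ≤ δ →
      ∃ J, HasSpectralIntegral E σ C (fun μ => opResolvent (addBounded A (B ∘L Q)) μ) J :=
    fun Q hQ => exists_hasSpectralIntegral hσ hC
      (continuousOn_opResolvent (fun μ hμ => (hres Q hQ μ hμ).1) fun μ hμ => (hres Q hQ μ hμ).2)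
      fun μ hμ => (hres Q hQ μ hμ).2
  have hΦ : ∀ Q : H →L[ℂ] K, ‖Q‖ ≤ δ →
      HasSpectralIntegral E σ C (fun μ => opResolvent (addBounded A (B ∘L Q)) μ) (Φ Q) :=
    fun Q hQ => hasSpectralIntegral_spectralIntegral (hex Q hQ)
  have hsolves : ∀ Q : H →L[ℂ] K, ‖Q‖ ≤ δ → (SolvesQEquation A A' E B Q ↔ Φ Q = Q) :=
    fun Q hQ => ⟨fun h => h.2.symm, fun h =>
      ⟨⟨fun μ hμ => (hres Q hQ μ hμ).1, ⟨r, fun μ hμ => (hres Q hQ μ hμ).2⟩, hex Q hQ⟩, h.symm⟩⟩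
  have hmaps : ∀ Q : H →L[ℂ] K, ‖Q‖ ≤ δ → ‖Φ Q‖ ≤ δ := by
    intro Q hQ
    -- Comparison with the integral of `0` turns the difference estimate into a norm bound.
    have h1 := (hΦ Q hQ).norm_sub_le hσ hC hasSpectralIntegral_zero hr0
      (fun μ hμ => by simpa using (hres Q hQ μ hμ).2)
    rw [sub_zero, hCb, mul_comm] at h1
    exact h1.trans hb2
  have hcontr : ∀ Q Q' : H →L[ℂ] K, ‖Q‖ ≤ δ → ‖Q'‖ ≤ δ →
      ‖Φ Q - Φ Q'‖ ≤ (b * r) ^ 2 * ‖Q - Q'‖ := by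
    intro Q Q' hQ hQ'
    -- The resolvents differ by a product of two resolvents, each at most `r`, around `B (Q' - Q)`;
    -- integration adds the second factor `b`.
    have h1 := (hΦ Q hQ).norm_sub_le hσ hC (hΦ Q' hQ') (c := r * ((b * ‖Q - Q'‖) * r))
      (by positivity) (fun μ hμ => by
        have h2 := hres Q hQ μ hμ
        have h3 := hres Q' hQ' μ hμ
        rw [(isResolventAt_opResolvent h2.1).sub_eq_of_addBounded
          (isResolventAt_opResolvent h3.1), ← ContinuousLinearMap.comp_sub]
        refine (norm_comp_comp_le _ _ _).trans ?_
        have h4 : ‖B ∘L (Q' - Q)‖ ≤ b * ‖Q - Q'‖ := by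
          rw [norm_sub_rev]
          refine (B.opNorm_comp_le _).trans ?_
          gcongr
          exact norm_le_toReal_hsNorm hB
        gcongr
        · exact h2.2
        · exact h3.2)
    rw [hCb] at h1
    linarith
  have hk : (b * r) ^ 2 < 1 := pow_lt_one₀ (by positivity) hbr two_ne_zero
  obtain ⟨Q, hQ, hfix⟩ : ∃ Q : H →L[ℂ] K, ‖Q‖ ≤ δ ∧ Φ Q = Q := by
    have hm : Set.MapsTo Φ (Metric.closedBall 0 δ) (Metric.closedBall 0 δ) := fun Q hQ => by
      simpa using hmaps Q (by simpa using hQ)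
    have hcw : ContractingWith ((b * r) ^ 2).toNNReal
        (hm.restrict Φ (Metric.closedBall 0 δ) (Metric.closedBall 0 δ)) := by
      refine ⟨by simpa using hk, LipschitzWith.of_dist_le_mul fun Q Q' => ?_⟩
      rw [Real.coe_toNNReal _ (sq_nonneg _), Subtype.dist_eq, Subtype.dist_eq, dist_eq_norm,
        dist_eq_norm]
      exact hcontr _ _ (mem_closedBall_zero_iff.1 Q.2) (mem_closedBall_zero_iff.1 Q'.2)
    obtain ⟨Q, hQ, hfix, -⟩ := hcw.exists_fixedPoint' Metric.isClosed_closedBall.isComplete hm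
      (x := 0) (by simpa using hδ.le) (edist_ne_top _ _)
    exact ⟨Q, by simpa using hQ, hfix⟩
  refine ⟨Q, ⟨hQ, (hsolves Q hQ).2 hfix⟩, fun Q' hQ' => ?_⟩
  have h1 := hcontr Q' Q hQ'.1 hQ
  rw [hfix, (hsolves Q' hQ'.1).1 hQ'.2] at h1
  have h2 : ‖Q' - Q‖ ≤ 0 := by nlinarith [norm_nonneg (Q' - Q)]
  exact sub_eq_zero.1 (norm_le_zero_iff.1 h2)

end NonlinearEquation

end

theorem theorem1 {H K : Type*}
    [NormedAddCommGroup H] [InnerProductSpace ℂ H] [CompleteSpace H]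
    [NormedAddCommGroup K] [InnerProductSpace ℂ K] [CompleteSpace K]
    (A : H →ₗ.[ℂ] H) (A' : K →ₗ.[ℂ] K) (hA : IsSelfAdjoint A) (hA' : IsSelfAdjoint A')
    (E : ProjMeasure K) (hE : IsSpectralMeasure A' E)
    (B : K →L[ℂ] H) (hd : 0 < specDist A A') :
    (∀ δ : ℝ, 0 < δ →
      hsNorm B < specDist A A' * ENNReal.ofReal (min (1 / (1 + δ)) (δ / (1 + δ ^ 2))) →
      ∃! Q : H →L[ℂ] K, ‖Q‖ ≤ δ ∧ SolvesQEquation A A' E B Q) ∧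
    (hsNorm B < specDist A A' / 2 →
      ∃! Q : H →L[ℂ] K, ‖Q‖ ≤ 1 ∧ SolvesQEquation A A' E B Q) ∧
    (∀ Q : H →L[ℂ] K, SolvesQEquation A A' E B Q →
      SolvesBasicEquation A A' E B (addBounded A (B ∘L Q))) := by
  refine ⟨fun δ hδ h => existsUnique_solvesQEquation hA E B hδ h, fun h => ?_,
    fun Q hQ => hQ.solvesBasicEquation⟩
  refine existsUnique_solvesQEquation hA E B one_pos (h.trans_eq ?_)
  -- At `δ = 1` both terms of the minimum equal `1/2`.
  have h1 : min (1 / (1 + 1)) (1 / (1 + 1 ^ 2)) = (2 : ℝ)⁻¹ := by norm_num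
  rw [h1, ENNReal.ofReal_inv_of_pos two_pos, ENNReal.ofReal_ofNat, div_eq_mul_inv]
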